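/- Let $\mathcal H$ be a complex separable Hilbert space (possibly finite-dimensional). Call a bounded operator $A$ on $\mathcal H$ a partial isometry if $A^*A$ and $AA^*$ are both self-adjoint projections. Let $\mathcal S$ be a set of partial isometries on $\mathcal H$ that is closed under multiplication, is irreducible (the only closed subspaces of $\mathcal H$ invariant under every operator in $\mathcal S$ are $\{0\}$ and $\mathcal H$), and contains a non-zero compact operator; $\mathcal S$ is not assumed to be closed under adjoints or norm-closed. Then the self-adjoint semigroup generated by $\mathcal S$, that is, the set of all finite products $A_1A_2\cdots A_k$ with $k\ge 1$ and, for each $i$, $A_i\in\mathcal S$ or $A_i^*\in\mathcal S$, consists of partial isometries. -/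

import Mathlib

open scoped Pointwise

/-- A bounded operator `A` on a Hilbert space is a partial isometry if both `A* A` and `A A*` are
self-adjoint projections. -/
def IsPartialIsometry {H : Type*} [NormedAddCommGroup H] [InnerProductSpace ℂ H] [CompleteSpace H]
    (A : H →L[ℂ] H) : Prop :=
  IsStarProjection (star A * A) ∧ IsStarProjection (A * star A)

/-- A semigroup of bounded operators is irreducible if the only closed subspaces invariant under
all its members are `{0}` and the whole space. -/
def IsIrreducibleSemigroup {H : Type*} [NormedAddCommGroup H] [InnerProductSpace ℂ H]
    (S : Subsemigroup (H →L[ℂ] H)) : Prop :=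
  ∀ M : Submodule ℂ H, IsClosed (M : Set H) →
    (∀ A ∈ S, ∀ x ∈ M, A x ∈ M) → M = ⊥ ∨ M = ⊤

/-- The self-adjoint semigroup generated by `S`: the multiplicative semigroup generated by the
members of `S` and their adjoints (`star` is the Hilbert space adjoint, applied elementwise). -/
noncomputable def selfAdjointSemigroupGenerated {H : Type*} [NormedAddCommGroup H]
    [InnerProductSpace ℂ H] [CompleteSpace H] (S : Subsemigroup (H →L[ℂ] H)) :
    Subsemigroup (H →L[ℂ] H) :=
  Subsemigroup.closure ((S : Set (H →L[ℂ] H)) ∪ star (S : Set (H →L[ℂ] H)))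

/-!
A compact partial isometry has finite rank, so `S` has non-zero members `B` of least finite rank.
If `A ∈ S` and `A B ≠ 0`, then `A` is injective on the range of `B`; since `A`, `B` and `A B` are
partial isometries, the projections `A* A` and `B B*` commute, and injectivity upgrades this to
`A* A B = B`. Thus every `A ∈ S` maps the range of each `B` either to zero or isometrically onto
the range of another least-rank member. Irreducibility shows that the ranges of the `B*` are the
same subspaces, so the adjoints of members of `S` act in the same way, and hence so do all
products. Finally these ranges span a dense subspace, so each such product `W` satisfies
`W W* W = W`.
-/

section PartialIsometry

/-- A partial isometry in a type with multiplication and involution, encoded by the equation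
`A A* A = A`, which avoids mentioning projections. -/
def IsPartialIsometryElem {R : Type*} [Mul R] [Star R] (A : R) : Prop :=
  A * star A * A = A

protected theorem IsPartialIsometryElem.eq {R : Type*} [Mul R] [Star R] {A : R}
    (hA : IsPartialIsometryElem A) : A * star A * A = A :=
  hA

protected theorem IsPartialIsometryElem.star {R : Type*} [Semigroup R] [StarMul R] {A : R}
    (hA : IsPartialIsometryElem A) : IsPartialIsometryElem (star A) := by
  simpa only [IsPartialIsometryElem, star_mul, star_star, mul_assoc] using congrArg Star.star hA.eq

variable {R : Type*} [NonUnitalNormedRing R] [StarRing R] [CStarRing R] {A B P Q : R}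

theorem isStarProjection_star_mul_self_iff :
    IsStarProjection (star A * A) ↔ IsPartialIsometryElem A := by
  refine ⟨fun h => ?_, fun h => ⟨?_, .star_mul_self A⟩⟩
  · have idem : star A * A * (star A * A) = star A * A := h.isIdempotentElem
    rw [IsPartialIsometryElem, ← sub_eq_zero, ← CStarRing.star_mul_self_eq_zero_iff]
    calc star (A * star A * A - A) * (A * star A * A - A)
        = star A * A * (star A * A) * (star A * A) - star A * A * (star A * A)
          - (star A * A * (star A * A) - star A * A) := by
          simp only [star_sub, star_mul, star_star]; noncomm_ring
      _ = 0 := by simp only [idem, sub_self]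
  · rw [IsIdempotentElem, mul_assoc, ← mul_assoc A, h.eq]

theorem isStarProjection_mul_star_self_iff :
    IsStarProjection (A * star A) ↔ IsPartialIsometryElem A := by
  have h := isStarProjection_star_mul_self_iff (A := star A)
  rw [star_star] at h
  exact h.trans ⟨fun hA => by simpa only [star_star] using hA.star, .star⟩

theorem commute_of_isIdempotentElem_mul (hP : IsStarProjection P) (hQ : IsStarProjection Q)
    (hPQ : IsIdempotentElem (P * Q)) : Commute P Q := by
  have compress : P * Q * P = Q * P := by
    rw [← sub_eq_zero, ← CStarRing.star_mul_self_eq_zero_iff]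
    calc star (P * Q * P - Q * P) * (P * Q * P - Q * P)
        = P * Q * (P * P) * Q * P - P * Q * P * Q * P - P * Q * P * Q * P + P * (Q * Q) * P := by
          simp only [star_sub, star_mul, hP.isSelfAdjoint.star_eq, hQ.isSelfAdjoint.star_eq]
          noncomm_ring
      _ = P * Q * P - P * Q * (P * Q) * P := by
          rw [hP.isIdempotentElem.eq, hQ.isIdempotentElem.eq]; noncomm_ring
      _ = 0 := by rw [hPQ.eq, sub_self]
  have compress_star : P * Q * P = P * Q := by
    simpa only [star_mul, hP.isSelfAdjoint.star_eq, hQ.isSelfAdjoint.star_eq, mul_assoc]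
      using congrArg star compress
  exact compress_star.symm.trans compress

theorem IsPartialIsometryElem.commute_of_mul (hA : IsPartialIsometryElem A)
    (hB : IsPartialIsometryElem B) (hAB : IsPartialIsometryElem (A * B)) :
    Commute (star A * A) (B * star B) := by
  refine commute_of_isIdempotentElem_mul (isStarProjection_star_mul_self_iff.2 hA)
    (isStarProjection_mul_star_self_iff.2 hB) ?_
  calc star A * A * (B * star B) * (star A * A * (B * star B))
      = star A * (A * B * star (A * B) * (A * B)) * star B := by
        simp only [star_mul, mul_assoc]
    _ = star A * A * (B * star B) := by rw [hAB.eq]; simp only [mul_assoc]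

end PartialIsometry

section Cancellation

variable {R : Type*} [NormedRing R] [StarRing R] [CStarRing R] {A B : R}

theorem IsPartialIsometryElem.star_mul_self_mul_of_cancel (hA : IsPartialIsometryElem A)
    (hB : IsPartialIsometryElem B) (hAB : IsPartialIsometryElem (A * B))
    (hcancel : ∀ Y, A * B * Y = 0 → B * Y = 0) : star A * A * B = B := by
  have hcomm : star A * A * (B * star B) = B * star B * (star A * A) := hA.commute_of_mul hB hAB
  have hdefect : B * (star B * (star A * A) * B - 1) = 0 := by
    refine hcancel _ ?_
    calc A * B * (star B * (star A * A) * B - 1)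
        = A * (B * star B * (star A * A)) * B - A * B := by noncomm_ring
      _ = A * star A * A * (B * star B * B) - A * B := by rw [← hcomm]; noncomm_ring
      _ = 0 := by rw [hA.eq, hB.eq, sub_self]
  calc star A * A * B = star A * A * (B * star B) * B := by
        rw [mul_assoc _ (B * star B), hB.eq]
    _ = B * (star B * (star A * A) * B - 1) + B := by rw [hcomm]; noncomm_ring
    _ = B := by rw [hdefect, zero_add]

theorem IsPartialIsometryElem.mul_mul_star_self_of_cancel (hA : IsPartialIsometryElem A)
    (hB : IsPartialIsometryElem B) (hAB : IsPartialIsometryElem (A * B))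
    (hcancel : ∀ Y, Y * (A * B) = 0 → Y * A = 0) : A * (B * star B) = A := by
  have hadj : star (star B) * star B * star A = star A := by
    refine hB.star.star_mul_self_mul_of_cancel hA.star (star_mul A B ▸ hAB.star) fun Y hY => ?_
    have hY' : star Y * (A * B) = 0 := by
      simpa only [star_mul, star_star, star_zero, mul_assoc] using congrArg star hY
    simpa only [star_mul, star_star, star_zero] using congrArg star (hcancel _ hY')
  simpa only [star_mul, star_star] using congrArg star hadj

end Cancellation

section AnnihilatorStable

/-- A non-zero member `B` of `S` whose right (left) annihilator does not grow when `B` is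
multiplied on the left (right) by a member of `S`, unless the product vanishes. This is the
algebraic substitute for "non-zero of least rank". -/
structure IsAnnihilatorStable {R : Type*} [SemigroupWithZero R] (S : Subsemigroup R) (B : R) :
    Prop where
  mem : B ∈ S
  ne_zero : B ≠ 0
  cancel_left : ∀ A ∈ S, A * B ≠ 0 → ∀ Y, A * B * Y = 0 → B * Y = 0
  cancel_right : ∀ A ∈ S, B * A ≠ 0 → ∀ Y, Y * (B * A) = 0 → Y * B = 0

namespace IsAnnihilatorStable

section SemigroupWithZero

variable {R : Type*} [SemigroupWithZero R] {S : Subsemigroup R} {A B : R}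

theorem mul_left (hB : IsAnnihilatorStable S B) (hA : A ∈ S) (hAB : A * B ≠ 0) :
    IsAnnihilatorStable S (A * B) where
  mem := S.mul_mem hA hB.mem
  ne_zero := hAB
  cancel_left T hT hTAB Y hY := by
    rw [← mul_assoc] at hTAB hY
    rw [mul_assoc, hB.cancel_left _ (S.mul_mem hT hA) hTAB Y hY, mul_zero]
  cancel_right T hT hABT Y hY := by
    rw [mul_assoc] at hABT
    rw [← mul_assoc]
    refine hB.cancel_right T hT (right_ne_zero_of_mul hABT) (Y * A) ?_
    simpa only [mul_assoc] using hY

theorem mul_right (hA : IsAnnihilatorStable S A) (hB : B ∈ S) (hAB : A * B ≠ 0) :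
    IsAnnihilatorStable S (A * B) where
  mem := S.mul_mem hA.mem hB
  ne_zero := hAB
  cancel_left T hT hTAB Y hY := by
    rw [← mul_assoc] at hTAB
    rw [mul_assoc]
    refine hA.cancel_left T hT (left_ne_zero_of_mul hTAB) (B * Y) ?_
    simpa only [mul_assoc] using hY
  cancel_right T hT hABT Y hY := by
    rw [mul_assoc] at hABT hY
    rw [← mul_assoc, hA.cancel_right _ (S.mul_mem hB hT) hABT Y hY, zero_mul]

end SemigroupWithZero

variable {R : Type*} [NormedRing R] [StarRing R] [CStarRing R] {S : Subsemigroup R} {A B : R}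

theorem star_mul_self_mul (hpi : ∀ A ∈ S, IsPartialIsometryElem A)
    (hB : IsAnnihilatorStable S B) (hA : A ∈ S) (hAB : A * B ≠ 0) : star A * A * B = B :=
  (hpi A hA).star_mul_self_mul_of_cancel (hpi B hB.mem) (hpi _ (S.mul_mem hA hB.mem))
    (hB.cancel_left A hA hAB)

theorem mul_mul_star_self (hpi : ∀ A ∈ S, IsPartialIsometryElem A)
    (hA : IsAnnihilatorStable S A) (hB : B ∈ S) (hAB : A * B ≠ 0) : A * (B * star B) = A :=
  (hpi A hA.mem).mul_mul_star_self_of_cancel (hpi B hB) (hpi _ (S.mul_mem hA.mem hB))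
    (hA.cancel_right B hB hAB)

end IsAnnihilatorStable

end AnnihilatorStable

section Prime

/-- One-sided analogue, for a subsemigroup `S` of `R`, of primeness of a ring: `X S B = 0` forces
`X = 0` or `B = 0`, where `B` is in `S` but `X` is an arbitrary element of `R`. -/
def IsPrimeSubsemigroup {R : Type*} [SemigroupWithZero R] (S : Subsemigroup R) : Prop :=
  ∀ ⦃X B : R⦄, X ≠ 0 → B ∈ S → B ≠ 0 → ∃ T ∈ S, X * T * B ≠ 0

namespace IsPrimeSubsemigroup

variable {R : Type*} [SemigroupWithZero R] {S : Subsemigroup R} {X B : R}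

theorem exists_mul_ne_zero (hS : IsPrimeSubsemigroup S) (hB : IsAnnihilatorStable S B)
    (hX : X ≠ 0) : ∃ C, IsAnnihilatorStable S C ∧ X * C ≠ 0 := by
  obtain ⟨T, hT, hXTB⟩ := hS hX hB.mem hB.ne_zero
  rw [mul_assoc] at hXTB
  exact ⟨T * B, hB.mul_left hT (right_ne_zero_of_mul hXTB), hXTB⟩

theorem exists_mul_self_ne_zero (hS : IsPrimeSubsemigroup S) (hB : IsAnnihilatorStable S B) :
    ∃ C, IsAnnihilatorStable S C ∧ C * B ≠ 0 := by
  obtain ⟨T, hT, hBTB⟩ := hS hB.ne_zero hB.mem hB.ne_zero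
  exact ⟨B * T, hB.mul_right hT (left_ne_zero_of_mul hBTB), hBTB⟩

end IsPrimeSubsemigroup

end Prime

section Blockwise

/-- For operators, with the ranges of the annihilator-stable members of `S` as blocks: `W` maps
each block either to zero or isometrically into another block. Membership of the range of `X` in
the block of a partial isometry `C` is encoded as `C C* X = X`. -/
def IsBlockwisePartialIsometry {R : Type*} [SemigroupWithZero R] [Star R]
    (S : Subsemigroup R) (W : R) : Prop :=
  ∀ B, IsAnnihilatorStable S B → W * B = 0 ∨
    star W * W * B = B ∧ ∃ C, IsAnnihilatorStable S C ∧ C * star C * (W * B) = W * B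

theorem IsBlockwisePartialIsometry.mul {R : Type*} [SemigroupWithZero R] [StarMul R]
    {S : Subsemigroup R} {V W : R} (hV : IsBlockwisePartialIsometry S V)
    (hW : IsBlockwisePartialIsometry S W) : IsBlockwisePartialIsometry S (V * W) := by
  intro B hB
  obtain hWB | ⟨hisoW, C, hC, hWC⟩ := hW B hB
  · exact .inl (by rw [mul_assoc, hWB, mul_zero])
  have hVWB : V * W * B = V * C * (star C * (W * B)) := by
    conv_lhs => rw [mul_assoc, ← hWC]
    simp only [mul_assoc]
  obtain hVC | ⟨hisoV, D, hD, hVD⟩ := hV C hC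
  · exact .inl (by rw [hVWB, hVC, zero_mul])
  refine .inr ⟨?_, D, hD, by rw [hVWB, ← mul_assoc, hVD]⟩
  calc star (V * W) * (V * W) * B = star W * (star V * (V * W * B)) := by
        simp only [star_mul, mul_assoc]
    _ = star W * (star V * V * C * (star C * (W * B))) := by rw [hVWB]; simp only [mul_assoc]
    _ = star W * (C * star C * (W * B)) := by rw [hisoV]; simp only [mul_assoc]
    _ = B := by rw [hWC, ← mul_assoc, hisoW]

theorem IsBlockwisePartialIsometry.isPartialIsometryElem {R : Type*} [NonUnitalRing R] [Star R]
    {S : Subsemigroup R} {E W : R} (hS : IsPrimeSubsemigroup S) (hE : IsAnnihilatorStable S E)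
    (hW : IsBlockwisePartialIsometry S W) :
    IsPartialIsometryElem W := by
  by_contra hne
  obtain ⟨B, hB, hne_B⟩ := hS.exists_mul_ne_zero hE (sub_ne_zero.2 hne)
  refine hne_B ?_
  rw [sub_mul, sub_eq_zero]
  obtain hWB | ⟨hiso, -⟩ := hW B hB
  · rw [mul_assoc, hWB, mul_zero]
  · rw [mul_assoc W, mul_assoc W, hiso]

variable {R : Type*} [NormedRing R] [StarRing R] [CStarRing R] {S : Subsemigroup R} {A W : R}

theorem isBlockwisePartialIsometry_of_mem (hpi : ∀ A ∈ S, IsPartialIsometryElem A) (hA : A ∈ S) :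
    IsBlockwisePartialIsometry S A := by
  intro B hB
  refine or_iff_not_imp_left.2 fun hAB => ?_
  have hABs := hB.mul_left hA hAB
  exact ⟨hB.star_mul_self_mul hpi hA hAB, A * B, hABs, hpi _ hABs.mem⟩

theorem isBlockwisePartialIsometry_star_of_mem (hpi : ∀ A ∈ S, IsPartialIsometryElem A)
    (hS : IsPrimeSubsemigroup S) (hA : A ∈ S) : IsBlockwisePartialIsometry S (star A) := by
  intro B hB
  obtain ⟨C, hC, hCB⟩ := hS.exists_mul_self_ne_zero hB
  -- `B = C* (C B)` has its range in that of `C*`, and `A* C* = (C A)*`.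
  have hB_eq : star C * (C * B) = B := by
    rw [← mul_assoc, hB.star_mul_self_mul hpi hC.mem hCB]
  have hAB_eq : star A * B = star (C * A) * (C * B) := by
    rw [star_mul, mul_assoc, hB_eq]
  obtain hCA | hCA := eq_or_ne (C * A) 0
  · exact .inl (by rw [hAB_eq, hCA, star_zero, zero_mul])
  have hCAs := hC.mul_right hA hCA
  obtain ⟨D, hD, hCAD⟩ := hS.exists_mul_ne_zero hB hCA
  refine .inr ⟨?_, D, hD, ?_⟩
  · have hAC : A * star A * star C = star C := by
      simpa only [star_mul, star_star] using congrArg star (hC.mul_mul_star_self hpi hA hCA)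
    rw [star_star, ← hB_eq, ← mul_assoc, hAC]
  · have hDCA : D * star D * star (C * A) = star (C * A) := by
      simpa only [star_mul, star_star] using
        congrArg star (hCAs.mul_mul_star_self hpi hD.mem hCAD)
    rw [hAB_eq, ← mul_assoc, hDCA]

theorem isPartialIsometryElem_of_mem_closure_union_star
    (hpi : ∀ A ∈ S, IsPartialIsometryElem A) (hS : IsPrimeSubsemigroup S)
    (hE : ∃ E, IsAnnihilatorStable S E)
    (hW : W ∈ Subsemigroup.closure ((S : Set R) ∪ star (S : Set R))) :
    IsPartialIsometryElem W := by
  obtain ⟨E, hE⟩ := hE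
  have hblock : IsBlockwisePartialIsometry S W := by
    refine Subsemigroup.closure_induction (fun A hA => ?_) (fun _ _ _ _ => .mul) hW
    obtain hA | hA := hA
    · exact isBlockwisePartialIsometry_of_mem hpi hA
    · simpa only [star_star] using
        isBlockwisePartialIsometry_star_of_mem hpi hS (Set.mem_star.1 hA)
  exact hblock.isPartialIsometryElem hS hE

end Blockwise

section FiniteRank

open Module (finrank)

variable {K V : Type*} [DivisionRing K] [TopologicalSpace V] [AddCommGroup V] [Module K V]
  {A B : V →L[K] V}

theorem mul_eq_zero_of_finrank_range_le_left [FiniteDimensional K B.range]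
    (h : finrank K B.range ≤ finrank K (A * B).range) {Y : V →L[K] V} (hY : A * B * Y = 0) :
    B * Y = 0 := by
  have hdisj : Disjoint B.range A.ker := by
    refine Submodule.disjoint_ker_of_finrank_le _ ?_
    rwa [← LinearMap.range_comp]
  ext x
  exact Submodule.disjoint_def.1 hdisj _ ⟨Y x, rfl⟩ (DFunLike.congr_fun hY x)

theorem mul_eq_zero_of_finrank_range_le_right [FiniteDimensional K A.range]
    (h : finrank K A.range ≤ finrank K (A * B).range) {Y : V →L[K] V} (hY : Y * (A * B) = 0) :
    Y * A = 0 := by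
  have hrange : (A * B).range = A.range :=
    Submodule.eq_of_le_of_finrank_le (LinearMap.range_comp_le_range _ _) h
  ext x
  obtain ⟨y, hy⟩ : A x ∈ (A * B).range := hrange ▸ LinearMap.mem_range_self _ x
  have hyA : A (B y) = A x := hy
  calc Y (A x) = Y (A (B y)) := by rw [hyA]
    _ = 0 := DFunLike.congr_fun hY y

theorem exists_isAnnihilatorStable {S : Subsemigroup (V →L[K] V)}
    (h : ∃ A ∈ S, A ≠ 0 ∧ FiniteDimensional K A.range) : ∃ E, IsAnnihilatorStable S E := by
  obtain ⟨E, ⟨hE, hE0, hEfin⟩, hmin⟩ := exists_minimalFor_of_wellFoundedLT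
    (fun A : V →L[K] V => A ∈ S ∧ A ≠ 0 ∧ FiniteDimensional K A.range)
    (fun A => finrank K A.range) h
  have hleast : ∀ B ∈ S, B ≠ 0 → FiniteDimensional K B.range →
      finrank K E.range ≤ finrank K B.range := fun B hB hB0 hBfin =>
    (le_total _ _).elim id fun hle => hmin ⟨hB, hB0, hBfin⟩ hle
  refine ⟨E, hE, hE0, fun A hA hAE Y => ?_, fun A hA hEA Y => ?_⟩
  · have hfin : FiniteDimensional K (A * E).range :=
      (LinearMap.range_comp (E : V →ₗ[K] V) (A : V →ₗ[K] V)).symm ▸ inferInstance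
    exact mul_eq_zero_of_finrank_range_le_left (hleast _ (S.mul_mem hA hE) hAE hfin)
  · have hfin : FiniteDimensional K (E * A).range :=
      Submodule.finiteDimensional_of_le (LinearMap.range_comp_le_range _ _)
    exact mul_eq_zero_of_finrank_range_le_right (hleast _ (S.mul_mem hE hA) hEA hfin)

end FiniteRank

section HilbertSpace

theorem finiteDimensional_range_of_isCompactOperator {𝕜 H : Type*} [RCLike 𝕜]
    [NormedAddCommGroup H] [InnerProductSpace 𝕜 H] [CompleteSpace H] {A : H →L[𝕜] H}
    (hA : IsPartialIsometryElem A) (hcpt : IsCompactOperator A) :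
    FiniteDimensional 𝕜 A.range := by
  have hproj : IsCompactOperator (A * star A) := hcpt.comp_clm (star A)
  have hfin := ContinuousLinearMap.finite_dimensional_eigenspace hproj 1 one_ne_zero
  have hle : A.range ≤ Module.End.eigenspace (A * star A).toLinearMap 1 := by
    rintro _ ⟨x, rfl⟩
    rw [Module.End.mem_eigenspace_iff, one_smul]
    exact DFunLike.congr_fun hA.eq x
  exact Submodule.finiteDimensional_of_le hle

namespace IsIrreducibleSemigroup

variable {H : Type*} [NormedAddCommGroup H] [InnerProductSpace ℂ H]
  {S : Subsemigroup (H →L[ℂ] H)} {X B : H →L[ℂ] H}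

theorem eq_zero_of_forall_mul_eq_zero (hS : IsIrreducibleSemigroup S) (hB : B ∈ S) (hB0 : B ≠ 0)
    (hX : ∀ T ∈ S, X * T = 0) : X = 0 := by
  let N : Submodule ℂ H := ⨆ T : S, T.1.range
  have hrange : ∀ T ∈ S, ∀ x, T x ∈ N.topologicalClosure := fun T hT x =>
    N.le_topologicalClosure (Submodule.mem_iSup_of_mem (⟨T, hT⟩ : S) ⟨x, rfl⟩)
  obtain hbot | htop := hS _ N.isClosed_topologicalClosure fun T hT x _ => hrange T hT x
  · refine absurd (ContinuousLinearMap.ext fun x => ?_) hB0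
    exact (Submodule.mem_bot ℂ).1 (hbot ▸ hrange B hB x)
  · have hker : N.topologicalClosure ≤ X.ker := by
      refine N.topologicalClosure_minimal (iSup_le fun T => ?_) X.isClosed_ker
      rintro _ ⟨x, rfl⟩
      exact DFunLike.congr_fun (hX T T.2) x
    ext x
    exact hker (htop ▸ Submodule.mem_top)

theorem isPrimeSubsemigroup (hS : IsIrreducibleSemigroup S) : IsPrimeSubsemigroup S := by
  intro X B hX hB hB0
  by_contra! hXTB
  let M : Submodule ℂ H := ⨅ T : S, (X * T.1).ker
  have mem_M : ∀ x, x ∈ M ↔ ∀ T ∈ S, X (T x) = 0 := fun x => by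
    simp [M]
  have hclosed : IsClosed (M : Set H) := by
    simp only [M, Submodule.coe_iInf]
    exact isClosed_iInter fun T => (X * T.1).isClosed_ker
  have hinv : ∀ A ∈ S, ∀ x ∈ M, A x ∈ M := fun A hA x hx =>
    (mem_M _).2 fun T hT => (mem_M x).1 hx (T * A) (S.mul_mem hT hA)
  obtain hbot | htop := hS M hclosed hinv
  · refine hB0 (ContinuousLinearMap.ext fun x => ?_)
    have hBx : B x ∈ M := (mem_M _).2 fun T hT => DFunLike.congr_fun (hXTB T hT) x
    exact (Submodule.mem_bot ℂ).1 (hbot ▸ hBx)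
  · refine hX (hS.eq_zero_of_forall_mul_eq_zero hB hB0 fun T hT => ?_)
    ext x
    exact (mem_M x).1 (htop ▸ Submodule.mem_top) T hT

end IsIrreducibleSemigroup

theorem isPartialIsometry_iff {H : Type*} [NormedAddCommGroup H] [InnerProductSpace ℂ H]
    [CompleteSpace H] {A : H →L[ℂ] H} : IsPartialIsometry A ↔ IsPartialIsometryElem A := by
  rw [IsPartialIsometry, isStarProjection_star_mul_self_iff, isStarProjection_mul_star_self_iff,
    and_self]

end HilbertSpace

theorem corollary3p14_general {H : Type*} [NormedAddCommGroup H] [InnerProductSpace ℂ H]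
    [CompleteSpace H] (S : Subsemigroup (H →L[ℂ] H))
    (hpi : ∀ A ∈ S, IsPartialIsometry A)
    (hirr : IsIrreducibleSemigroup S)
    (hcpt : ∃ K ∈ S, K ≠ 0 ∧ IsCompactOperator K) :
    ∀ A ∈ selfAdjointSemigroupGenerated S, IsPartialIsometry A := by
  simp only [isPartialIsometry_iff] at hpi ⊢
  obtain ⟨K, hK, hK0, hKcpt⟩ := hcpt
  have hstable : ∃ E, IsAnnihilatorStable S E := exists_isAnnihilatorStable
    ⟨K, hK, hK0, finiteDimensional_range_of_isCompactOperator (hpi K hK) hKcpt⟩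
  exact fun A hA =>
    isPartialIsometryElem_of_mem_closure_union_star hpi hirr.isPrimeSubsemigroup hstable hA

theorem corollary3p14 {H : Type*} [NormedAddCommGroup H] [InnerProductSpace ℂ H]
    [CompleteSpace H] [TopologicalSpace.SeparableSpace H]
    (S : Subsemigroup (H →L[ℂ] H))
    (hpi : ∀ A ∈ S, IsPartialIsometry A)
    (hirr : IsIrreducibleSemigroup S)
    (hcpt : ∃ K ∈ S, K ≠ 0 ∧ IsCompactOperator K) :
    ∀ A ∈ selfAdjointSemigroupGenerated S, IsPartialIsometry A :=
  corollary3p14_general S hpi hirr hcpt
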